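/- Let $d \ge 0$ and let $P$ and $Q$ be polygonal curves in $\mathbb{R}^d$ with $m \ge 0$ and $n \ge 0$ edges and vertices $p_0,\dots,p_m$ and $q_0,\dots,q_n$, regarded as maps $P : [0,m] \to \mathbb{R}^d$, $P(i+\lambda) = (1-\lambda)p_i + \lambda p_{i+1}$ for integers $0 \le i < m$ and $0 \le \lambda \le 1$ (and $P(0) = p_0$ if $m = 0$), and likewise $Q : [0,n] \to \mathbb{R}^d$. For $0 \le x_0 \le x_1 \le m$ and $0 \le y_0 \le y_1 \le n$, a matching of $P|_{[x_0,x_1]}$ and $Q|_{[y_0,y_1]}$ is a pair $\mu = (\sigma,\theta)$ of continuous non-decreasing functions $\sigma : [0,1] \to [x_0,x_1]$, $\theta : [0,1] \to [y_0,y_1]$ with $\sigma(0)=x_0$, $\sigma(1)=x_1$, $\theta(0)=y_0$, $\theta(1)=y_1$. Put $d_\mu[a,b] = \max_{a \le t \le b} |P(\sigma(t)) - Q(\theta(t))|$ (Euclidean norm), and let the Fréchet distance $\delta_F(P|_{[x_0,x_1]}, Q|_{[y_0,y_1]})$ be the infimum of $d_\mu[0,1]$ over all matchings $\mu$ of these two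 subcurves. Then there is a matching $\mu = (\sigma,\theta)$ of $P$ and $Q$ which is a Fréchet matching, that is, $d_\mu[0,1] = \delta_F(P,Q)$, and which is locally correct, that is, for all $0 \le a \le b \le 1$, $$d_\mu[a,b] = \delta_F\bigl(P|_{[\sigma(a),\sigma(b)]},\, Q|_{[\theta(a),\theta(b)]}\bigr).$$ -/

import Mathlib

open Set

noncomputable section

/-- A polygonal curve in `ℝᵈ` with `m` edges (`m = 0` is a single point), given by its vertices
`p₀, …, pₘ`. Consecutive vertices may coincide. -/
structure PolygonalCurve (d : ℕ) where
  /-- the number of edges -/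
  m : ℕ
  /-- the vertices -/
  vertex : Fin (m + 1) → EuclideanSpace ℝ (Fin d)

namespace PolygonalCurve

variable {d : ℕ}

/-- The vertex with index `min i m`. -/
def vertexAt (P : PolygonalCurve d) (i : ℕ) : EuclideanSpace ℝ (Fin d) :=
  P.vertex ⟨min i P.m, Nat.lt_succ_of_le (Nat.min_le_right i P.m)⟩

/-- The curve as a map on `[0, m]`: `P (i + l) = (1 - l) • pᵢ + l • pᵢ₊₁`.
Values outside `[0, m]` are never used. -/
def eval (P : PolygonalCurve d) (x : ℝ) : EuclideanSpace ℝ (Fin d) :=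
  (1 - (x - ⌊x⌋₊)) • P.vertexAt ⌊x⌋₊ + (x - ⌊x⌋₊) • P.vertexAt (⌊x⌋₊ + 1)

/-- On every closed edge, the last one included, the parametrization is the linear one. -/
theorem eval_add (P : PolygonalCurve d) (i : Fin P.m) (l : ℝ) (h0 : 0 ≤ l) (h1 : l ≤ 1) :
    P.eval ((i : ℕ) + l) = (1 - l) • P.vertex i.castSucc + l • P.vertex i.succ := by
  have hi : P.vertexAt (i : ℕ) = P.vertex i.castSucc := by
    unfold vertexAt; congr 1; ext; simp
  have hs : P.vertexAt ((i : ℕ) + 1) = P.vertex i.succ := by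
    unfold vertexAt; congr 1; ext; simp
  rcases h1.lt_or_eq with h | rfl
  · have hf : ⌊((i : ℕ) : ℝ) + l⌋₊ = (i : ℕ) := by
      rw [Nat.floor_eq_iff (by positivity)]
      constructor <;> linarith
    unfold eval
    rw [hf, hi, hs]
    simp
  · have hf : ⌊((i : ℕ) : ℝ) + 1⌋₊ = (i : ℕ) + 1 := by
      exact_mod_cast Nat.floor_natCast ((i : ℕ) + 1)
    unfold eval
    rw [hf, hs]
    simp

end PolygonalCurve

/-- `σ`, restricted to `[0, 1]`, is a continuous non-decreasing map onto `[x₀, x₁]`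
(with `σ 0 = x₀` and `σ 1 = x₁`). -/
structure IsReparam (x₀ x₁ : ℝ) (σ : ℝ → ℝ) : Prop where
  continuousOn : ContinuousOn σ (Icc 0 1)
  monotoneOn : MonotoneOn σ (Icc 0 1)
  map_zero : σ 0 = x₀
  map_one : σ 1 = x₁

/-- The maximum distance of matched points over the range `a ≤ t ≤ b`. -/
def maxDist {d : ℕ} (P Q : PolygonalCurve d) (σ θ : ℝ → ℝ) (a b : ℝ) : ℝ :=
  sSup ((fun t => dist (P.eval (σ t)) (Q.eval (θ t))) '' Icc a b)

/-- The Fréchet distance between the subcurve of `P` with parameter range `[x₀, x₁]` and the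
subcurve of `Q` with parameter range `[y₀, y₁]`: the infimum, over all monotone matchings of the
two subcurves, of the maximum distance of matched points. -/
def subcurveFrechetDist {d : ℕ} (P Q : PolygonalCurve d) (x₀ x₁ y₀ y₁ : ℝ) : ℝ :=
  sInf {r | ∃ σ θ : ℝ → ℝ, IsReparam x₀ x₁ σ ∧ IsReparam y₀ y₁ θ ∧ r = maxDist P Q σ θ 0 1}

/-- The Fréchet distance between two polygonal curves. -/
def frechetDist {d : ℕ} (P Q : PolygonalCurve d) : ℝ :=
  subcurveFrechetDist P Q 0 P.m 0 Q.m

/-- A (monotone) matching between `P` and `Q`. -/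
structure IsMatching {d : ℕ} (P Q : PolygonalCurve d) (σ θ : ℝ → ℝ) : Prop where
  left : IsReparam 0 P.m σ
  right : IsReparam 0 Q.m θ

/-- A Fréchet matching: a matching that realizes the Fréchet distance. -/
def IsFrechetMatching {d : ℕ} (P Q : PolygonalCurve d) (σ θ : ℝ → ℝ) : Prop :=
  IsMatching P Q σ θ ∧ maxDist P Q σ θ 0 1 = frechetDist P Q

/-- A locally correct matching: on every range `[a, b]`, the maximum distance of matched points is
the Fréchet distance of the two matched subcurves. -/
def IsLocallyCorrect {d : ℕ} (P Q : PolygonalCurve d) (σ θ : ℝ → ℝ) : Prop :=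
  IsMatching P Q σ θ ∧
    ∀ a b : ℝ, 0 ≤ a → a ≤ b → b ≤ 1 →
      maxDist P Q σ θ a b = subcurveFrechetDist P Q (σ a) (σ b) (θ a) (θ b)

end

/-! Parametrized by the sum of its two coordinates, a matching becomes a 1-Lipschitz path `x`, and
such paths with fixed ends form a compact set. With `G s y` the distance of `P y` and `Q (s - y)`,
let `z k` minimize the integral of `G ^ k` and let `x` be a limit of the `z k`
(`exists_bottleneck_path`). Suppose a rival `r` beat `x` in maximum on some subrange. Rerouting `z
k` along `r` there (`IsMonotonePath.exists_reroute`) would bound its integral by a smaller base to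
the power `k`, while `z k`, being close to `x`, pays a larger base on a window of fixed length. For
large `k` this contradicts minimality. -/

/-- The functions `x` for which both `x` and `s ↦ s - x s` are non-decreasing: the monotone paths
`s ↦ (x s, s - x s)` in the plane, parametrized by `ℓ¹` arc length. -/
def IsMonotonePath (x : ℝ → ℝ) : Prop :=
  ∀ s t, s ≤ t → x s ≤ x t ∧ x t - x s ≤ t - s

namespace IsMonotonePath

theorem abs_sub_le {x : ℝ → ℝ} (hx : IsMonotonePath x) (s t : ℝ) : |x s - x t| ≤ |s - t| := by
  rcases le_total s t with h | h
  · have := hx s t h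
    rw [abs_sub_comm, abs_of_nonneg (by linarith), abs_sub_comm, abs_of_nonneg (by linarith)]
    exact this.2
  · have := hx t s h
    rw [abs_of_nonneg (by linarith), abs_of_nonneg (by linarith)]
    exact this.2

theorem continuous {x : ℝ → ℝ} (hx : IsMonotonePath x) : Continuous x :=
  (LipschitzWith.of_dist_le_mul (K := 1) fun s t => by
    simpa [Real.dist_eq] using hx.abs_sub_le s t).continuous

end IsMonotonePath

/-- The monotone paths from `(0, 0)` to `(A, L - A)`. -/
def monotonePaths (L A : ℝ) : Set C(ℝ, ℝ) :=
  {x | IsMonotonePath x ∧ x 0 = 0 ∧ x L = A}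

theorem monotonePaths_nonempty {L A : ℝ} (hA : 0 ≤ A) (hAL : A ≤ L) :
    (monotonePaths L A).Nonempty := by
  refine ⟨⟨fun s => max 0 (min s A), by fun_prop⟩, fun s t hst => ?_, ?_, ?_⟩
  · change max 0 (min s A) ≤ max 0 (min t A) ∧ max 0 (min t A) - max 0 (min s A) ≤ t - s
    grind
  · simp [hA]
  · simp [hA, hAL]

/-- Arzelà–Ascoli: the paths are 1-Lipschitz, the conditions are pointwise closed, and the value `0`
at `0` gives `|x s| ≤ |s|`. -/
theorem isCompact_monotonePaths (L A : ℝ) : IsCompact (monotonePaths L A) := by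
  apply ArzelaAscoli.isCompact_of_equicontinuous
  · have himage : ContinuousMap.toFun '' monotonePaths L A =
        {x : ℝ → ℝ | IsMonotonePath x ∧ x 0 = 0 ∧ x L = A} := by
      ext x
      constructor
      · rintro ⟨y, hy, rfl⟩
        exact hy
      · intro hx
        exact ⟨⟨x, hx.1.continuous⟩, hx, rfl⟩
    rw [himage]
    refine (isCompact_univ_pi fun s : ℝ => isCompact_Icc (a := -|s|) (b := |s|)).of_isClosed_subset
      ?_ ?_
    · have hset : {x : ℝ → ℝ | IsMonotonePath x ∧ x 0 = 0 ∧ x L = A} =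
          (⋂ (s : ℝ) (t : ℝ) (_ : s ≤ t), {x : ℝ → ℝ | x s ≤ x t} ∩ {x | x t - x s ≤ t - s}) ∩
            ({x | x 0 = 0} ∩ {x | x L = A}) := by
        ext x
        simp [IsMonotonePath]
      rw [hset]
      refine IsClosed.inter ?_ ((isClosed_eq (continuous_apply 0) continuous_const).inter
        (isClosed_eq (continuous_apply L) continuous_const))
      refine isClosed_iInter fun s => isClosed_iInter fun t => isClosed_iInter fun _ => ?_
      exact (isClosed_le (continuous_apply s) (continuous_apply t)).inter
        (isClosed_le ((continuous_apply t).sub (continuous_apply s)) continuous_const)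
    · rintro x ⟨hx, h0, -⟩ s -
      have := hx.abs_sub_le s 0
      rw [h0, sub_zero, sub_zero] at this
      exact abs_le.mp this
  · refine LipschitzWith.uniformEquicontinuous _ 1 (fun x => ?_) |>.equicontinuous
    exact LipschitzWith.of_dist_le_mul fun s t => by
      simpa [Real.dist_eq] using x.2.1.abs_sub_le s t

theorem exists_integral_minimizer {G : ℝ → ℝ → ℝ} (hG : Continuous (Function.uncurry G))
    {L A : ℝ} (hA : 0 ≤ A) (hAL : A ≤ L) (k : ℕ) :
    ∃ z ∈ monotonePaths L A, ∀ w ∈ monotonePaths L A,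
      ∫ s in (0 : ℝ)..L, G s (z s) ^ k ≤ ∫ s in (0 : ℝ)..L, G s (w s) ^ k := by
  have hc : Continuous fun z : C(ℝ, ℝ) => ∫ s in (0 : ℝ)..L, G s (z s) ^ k := by
    apply intervalIntegral.continuous_parametric_intervalIntegral_of_continuous'
    have : Continuous fun p : C(ℝ, ℝ) × ℝ => Function.uncurry G (p.2, p.1 p.2) :=
      hG.comp (continuous_snd.prodMk continuous_eval)
    exact this.pow k
  obtain ⟨z, hz, hmin⟩ := (isCompact_monotonePaths L A).exists_isMinOn
    (monotonePaths_nonempty hA hAL) hc.continuousOn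
  exact ⟨z, hz, fun w hw => hmin hw⟩

/-! ### Rerouting a path -/

theorem max_step_le {a a' b b' d : ℝ} (ha : a ≤ a' ∧ a' - a ≤ d) (hb : b ≤ b' ∧ b' - b ≤ d) :
    max a b ≤ max a' b' ∧ max a' b' - max a b ≤ d := by
  grind

theorem min_step_le {a a' b b' d : ℝ} (ha : a ≤ a' ∧ a' - a ≤ d) (hb : b ≤ b' ∧ b' - b ≤ d) :
    min a b ≤ min a' b' ∧ min a' b' - min a b ≤ d := by
  grind

/-- A monotone path `z` can be rerouted between `u` and `v` along any partial monotone path `r`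
which stays in the parallelogram of a pair of endpoints `(u, a)`, `(v, b)` close to those of `z`. -/
theorem IsMonotonePath.exists_reroute {z r : ℝ → ℝ} {u v a b δ : ℝ} (hz : IsMonotonePath z)
    (huv : u ≤ v)
    (hr : ∀ s ∈ Icc u v, ∀ t ∈ Icc u v, s ≤ t → r s ≤ r t ∧ r t - r s ≤ t - s)
    (hrab : ∀ s ∈ Icc u v, a ≤ r s ∧ r s ≤ b ∧ u - a ≤ s - r s ∧ s - r s ≤ v - b)
    (ha : |z u - a| ≤ δ) (hb : |z v - b| ≤ δ) :
    ∃ w, IsMonotonePath w ∧ (∀ s ≤ u, w s = z s) ∧ (∀ s, v ≤ s → w s = z s) ∧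
      ∀ s ∈ Icc u v, |w s - r s| ≤ δ := by
  let c : ℝ → ℝ := fun s => max u (min s v)
  -- `r` clamped between the lowest and highest monotone paths joining the ends of `z`; the clamp
  -- moves it by at most `δ`.
  let r' : ℝ → ℝ := fun s =>
    max (max (z u) (z v - (v - s))) (min (min (z u + (s - u)) (z v)) (r s))
  have hzuv := hz u v huv
  rw [abs_le] at ha hb
  have hc : ∀ s, c s ∈ Icc u v := fun s => by simp only [c, mem_Icc]; grind
  have hcsum : ∀ s, min s u + c s + max s v = s + u + v := fun s => by
    simp only [c]
    clear hr hrab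
    grind
  have hcle : ∀ s t, s ≤ t → c s ≤ c t := fun s t hst => by simp only [c]; grind
  have hr'u : r' u = z u := by simp only [r']; clear_value c; clear hr hrab hz hcle hc; grind
  have hr'v : r' v = z v := by simp only [r']; clear_value c; clear hr hrab hz hcle hc; grind
  have hr' : ∀ s ∈ Icc u v, ∀ t ∈ Icc u v, s ≤ t → r' s ≤ r' t ∧ r' t - r' s ≤ t - s := by
    intro s hs t ht hst
    have hd : 0 ≤ t - s := by linarith
    have hconst : ∀ c : ℝ, c ≤ c ∧ c - c ≤ t - s := fun c => ⟨le_rfl, by linarith⟩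
    exact max_step_le (max_step_le (hconst _) ⟨by linarith, by linarith⟩)
      (min_step_le (min_step_le ⟨by linarith, by linarith⟩ (hconst _)) (hr s hs t ht hst))
  -- Three stopped paths are added; by `hcsum` their clocks together advance exactly as fast as `s`.
  refine ⟨fun s => z (min s u) - z u + r' (c s) + (z (max s v) - z v), ?_, ?_, ?_, ?_⟩
  · intro s t hst
    have h1 := hz (min s u) (min t u) (by gcongr)
    have h2 := hz (max s v) (max t v) (by gcongr)
    have h3 := hr' (c s) (hc s) (c t) (hc t) (hcle s t hst)
    have hs := hcsum s
    have ht := hcsum t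
    constructor <;> linarith
  · intro s hs
    have : c s = u := by simp only [c]; grind
    simp only [this, hr'u, min_eq_left hs, max_eq_right (hs.trans huv)]
    ring
  · intro s hs
    have : c s = v := by simp only [c]; grind
    simp only [this, hr'v, min_eq_right (huv.trans hs), max_eq_left hs]
    ring
  · intro s hs
    have : c s = s := by simp only [c]; grind
    have h := hrab s hs
    simp only [this, min_eq_right hs.1, max_eq_right hs.2, sub_self, zero_add, add_zero]
    have h1 : r' s ≤ r s + δ := by
      refine max_le (max_le ?_ ?_) (min_le_of_right_le ?_) <;> linarith
    have h2 : r s - δ ≤ r' s := by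
      refine le_max_of_le_right (le_min (le_min ?_ ?_) ?_) <;> linarith
    rw [abs_le]
    constructor <;> linarith

/-! ### Limit of the integral minimizers -/

/-- Among the monotone paths from `(0, 0)` to `(A, L - A)` there is one each of whose subpaths
minimizes the maximum of `G` among the monotone paths with the same endpoints. -/
theorem exists_bottleneck_path {G : ℝ → ℝ → ℝ} (hG : Continuous (Function.uncurry G))
    (hG0 : ∀ s y, 0 ≤ G s y) {L A : ℝ} (hA : 0 ≤ A) (hAL : A ≤ L) :
    ∃ x, IsMonotonePath x ∧ x 0 = 0 ∧ x L = A ∧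
      ∀ u v, 0 ≤ u → u < v → v ≤ L → ∀ (r : ℝ → ℝ) (B : ℝ),
        (∀ s ∈ Icc u v, ∀ t ∈ Icc u v, s ≤ t → r s ≤ r t ∧ r t - r s ≤ t - s) →
        (∀ s ∈ Icc u v, x u ≤ r s ∧ r s ≤ x v ∧ u - x u ≤ s - r s ∧ s - r s ≤ v - x v) →
        (∀ s ∈ Icc u v, G s (r s) ≤ B) → ∀ s ∈ Icc u v, G s (x s) ≤ B := by
  choose z hz hmin using exists_integral_minimizer hG hA hAL
  -- A nonprincipal ultrafilter replaces the choice of a convergent subsequence.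
  let U : Ultrafilter ℕ := Filter.hyperfilter ℕ
  obtain ⟨x, hx, hUx⟩ := (isCompact_monotonePaths L A).ultrafilter_le_nhds (U.map z) (by
    rw [Filter.le_principal_iff]
    exact Filter.mem_map.2 (Filter.univ_mem' hz))
  have hlim : ∀ s, Filter.Tendsto (fun k => z k s) U (nhds (x s)) := fun s =>
    ((continuous_eval_const s).tendsto x).comp (show Filter.Tendsto z U (nhds x) from hUx)
  refine ⟨x, hx.1, hx.2.1, hx.2.2, fun u v hu huv hv r B hr hrab hrB σ hσ => ?_⟩
  by_contra! hlt
  -- A third of the gap leaves `B + ε < M - ε`.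
  have hB : 0 ≤ B := (hG0 _ _).trans (hrB u (left_mem_Icc.2 huv.le))
  set M := G σ (x σ) with hM
  set ε := (M - B) / 3 with hε
  have hεpos : 0 < ε := by linarith
  have hUC := (isCompact_Icc.prod isCompact_Icc : IsCompact (Icc 0 L ×ˢ Icc 0 A)
    ).uniformContinuousOn_of_continuous hG.continuousOn
  obtain ⟨δ, hδ, hGδ⟩ := Metric.uniformContinuousOn_iff.1 hUC ε hεpos
  have hGδ' : ∀ s ∈ Icc 0 L, ∀ y ∈ Icc 0 A, ∀ s' ∈ Icc 0 L, ∀ y' ∈ Icc 0 A,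
      |s - s'| < δ → |y - y'| < δ → |G s y - G s' y'| < ε := by
    intro s hs y hy s' hs' y' hy' h1 h2
    simpa [Real.dist_eq] using hGδ (s, y) ⟨hs, hy⟩ (s', y') ⟨hs', hy'⟩ (by
      rw [Prod.dist_eq, max_lt_iff]
      exact ⟨h1, h2⟩)
  have hrange : ∀ y ∈ monotonePaths L A, ∀ s ∈ Icc 0 L, y s ∈ Icc 0 A := by
    rintro y ⟨hy, hy0, hyL⟩ s hs
    exact ⟨hy0 ▸ (hy 0 s hs.1).1, hyL ▸ (hy s L hs.2).1⟩
  have hsub : ∀ s ∈ Icc u v, s ∈ Icc 0 L := fun s hs => ⟨hu.trans hs.1, hs.2.trans hv⟩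
  -- On this window `z k` is within `δ` of `x σ`: half from the Lipschitz bound, half from
  -- convergence at `σ`.
  set u' := max u (σ - δ / 2)
  set v' := min v (σ + δ / 2)
  have huu' : u ≤ u' := le_max_left _ _
  have hvv' : v' ≤ v := min_le_left _ _
  have hu'v' : u' < v' := by
    simp only [u', v', max_lt_iff, lt_min_iff]
    refine ⟨⟨huv, ?_⟩, ?_, ?_⟩ <;> linarith [hσ.1, hσ.2]
  have hclose : ∀ s, ∀ᶠ k in (U : Filter ℕ), |z k s - x s| < δ / 2 := fun s => by
    simpa [Real.dist_eq] using Metric.tendsto_nhds.1 (hlim s) (δ / 2) (by linarith)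
  have hgrowth : ∀ᶠ k in Filter.atTop,
      (B + ε) ^ k * (v - u) < (M - ε) ^ k * (v' - u') := by
    have hγ : 0 < M - ε := by linarith
    have h := (tendsto_pow_atTop_nhds_zero_of_lt_one (r := (B + ε) / (M - ε)) (by positivity)
      ((div_lt_one hγ).2 (by linarith))).mul_const (v - u)
    rw [zero_mul] at h
    filter_upwards [h.eventually_lt_const (sub_pos.2 hu'v')] with k hk
    rw [div_pow, div_mul_eq_mul_div, div_lt_iff₀ (by positivity)] at hk
    linarith
  have hU : (U : Filter ℕ) ≤ Filter.atTop := Nat.hyperfilter_le_atTop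
  obtain ⟨k, hku, hkv, hkσ, hk⟩ := ((hclose u).and ((hclose v).and ((hclose σ).and
    (hgrowth.filter_mono hU)))).exists
  obtain ⟨w, hw, hwu, hwv, hwr⟩ := (hz k).1.exists_reroute huv.le hr hrab hku.le hkv.le
  have hwmem : (⟨w, hw.continuous⟩ : C(ℝ, ℝ)) ∈ monotonePaths L A :=
    ⟨hw, (hwu 0 hu).trans (hz k).2.1, (hwv L hv).trans (hz k).2.2⟩
  have hcont : ∀ y : ℝ → ℝ, Continuous y → Continuous fun s => G s (y s) ^ k := fun y hy =>
    (show Continuous fun s => Function.uncurry G (s, y s) from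
      hG.comp (continuous_id.prodMk hy)).pow k
  have hint : ∀ y : ℝ → ℝ, Continuous y → ∀ a b : ℝ,
      IntervalIntegrable (fun s => G s (y s) ^ k) MeasureTheory.volume a b := fun y hy a b =>
    (hcont y hy).intervalIntegrable a b
  have hsplit : ∀ y : ℝ → ℝ, Continuous y → ∫ s in (0 : ℝ)..L, G s (y s) ^ k =
      (∫ s in (0 : ℝ)..u, G s (y s) ^ k) + (∫ s in u..v, G s (y s) ^ k) +
        ∫ s in v..L, G s (y s) ^ k := fun y hy => by
    rw [intervalIntegral.integral_add_adjacent_intervals (hint y hy _ _) (hint y hy _ _),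
      intervalIntegral.integral_add_adjacent_intervals (hint y hy _ _) (hint y hy _ _)]
  -- Off `[u, v]` the paths `w` and `z k` agree, so minimality passes to `[u, v]`.
  have hle : ∫ s in u..v, G s (z k s) ^ k ≤ ∫ s in u..v, G s (w s) ^ k := by
    have h := hmin k _ hwmem
    change _ ≤ ∫ s in (0 : ℝ)..L, G s (w s) ^ k at h
    rw [hsplit _ (z k).continuous, hsplit _ hw.continuous] at h
    have h1 : ∫ s in (0 : ℝ)..u, G s (w s) ^ k = ∫ s in (0 : ℝ)..u, G s (z k s) ^ k :=
      intervalIntegral.integral_congr fun s hs => by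
        rw [uIcc_of_le hu] at hs
        simp only [hwu s hs.2]
    have h2 : ∫ s in v..L, G s (w s) ^ k = ∫ s in v..L, G s (z k s) ^ k :=
      intervalIntegral.integral_congr fun s hs => by
        rw [uIcc_of_le hv] at hs
        simp only [hwv s hs.1]
    linarith
  have hupper : ∫ s in u..v, G s (w s) ^ k ≤ (B + ε) ^ k * (v - u) := by
    have h := intervalIntegral.integral_mono_on huv.le (hint w hw.continuous u v)
      (intervalIntegrable_const (c := (B + ε) ^ k)) fun s hs => by
        have hrs := hrab s hs
        have hsL := hsub s hs
        have hru : r s ∈ Icc 0 A :=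
          ⟨(hrange x hx u (hsub u (left_mem_Icc.2 huv.le))).1.trans hrs.1,
            hrs.2.1.trans (hrange x hx v (hsub v (right_mem_Icc.2 huv.le))).2⟩
        have hd := hGδ' s hsL (w s) (hrange _ hwmem s hsL) s hsL (r s) hru (by simpa using hδ)
          (by linarith [hwr s hs])
        rw [abs_lt] at hd
        exact pow_le_pow_left₀ (hG0 _ _) (by linarith [hrB s hs]) k
    rw [intervalIntegral.integral_const, smul_eq_mul] at h
    linarith
  have hlower : (M - ε) ^ k * (v' - u') ≤ ∫ s in u..v, G s (z k s) ^ k := by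
    have h := intervalIntegral.integral_mono_on hu'v'.le
      (intervalIntegrable_const (c := (M - ε) ^ k)) (hint _ (z k).continuous u' v') fun s hs => by
        have hsuv : s ∈ Icc u v := ⟨huu'.trans hs.1, hs.2.trans hvv'⟩
        have hsL := hsub s hsuv
        have hσL := hsub σ hσ
        have hsσ : |s - σ| ≤ δ / 2 := by
          have h1 := (le_max_right _ _).trans hs.1
          have h2 := hs.2.trans (min_le_right _ _)
          rw [abs_le]
          constructor <;> linarith
        have hd := hGδ' s hsL (z k s) (hrange _ (hz k) s hsL) σ hσL (x σ) (hrange _ hx σ hσL)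
          (by linarith) (by
            calc |z k s - x σ| ≤ |z k s - z k σ| + |z k σ - x σ| := _root_.abs_sub_le _ _ _
              _ < δ := by linarith [(hz k).1.abs_sub_le s σ])
        rw [abs_lt] at hd
        exact pow_le_pow_left₀ (by linarith) (by linarith) k
    rw [intervalIntegral.integral_const, smul_eq_mul] at h
    have hmono : ∫ s in u'..v', G s (z k s) ^ k ≤ ∫ s in u..v, G s (z k s) ^ k :=
      intervalIntegral.integral_mono_interval huu' hu'v'.le hvv'
        (Filter.Eventually.of_forall fun s => pow_nonneg (hG0 _ _) k)
        (hint _ (z k).continuous u v)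
    linarith
  linarith

/-! ### Curves and matchings -/

namespace PolygonalCurve

variable {d : ℕ}

theorem continuous_eval (P : PolygonalCurve d) : Continuous P.eval := by
  have hlin : ∀ n : ℕ, Continuous fun x : ℝ =>
      (1 - (x - n)) • P.vertexAt n + (x - n) • P.vertexAt (n + 1) := fun n => by fun_prop
  have hIic : ∀ n : ℕ, ContinuousOn P.eval (Iic ((n : ℝ) + 1)) := by
    have hright : ∀ n : ℕ, P.eval ((n : ℝ) + 1) =
        (1 - ((n : ℝ) + 1 - n)) • P.vertexAt n + ((n : ℝ) + 1 - n) • P.vertexAt (n + 1) := by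
      intro n
      have hf : ⌊(n : ℝ) + 1⌋₊ = n + 1 := by exact_mod_cast Nat.floor_natCast (n + 1)
      simp [eval, hf]
    intro n
    induction n with
    -- The natural floor of a negative number is `0`, so one affine formula covers the whole
    -- half-line.
    | zero =>
      refine (hlin 0).continuousOn.congr fun x hx => ?_
      rcases (mem_Iic.1 hx).lt_or_eq with h | rfl
      · have hf : ⌊x⌋₊ = 0 := Nat.floor_eq_zero.2 (by simpa using h)
        simp only [eval, hf]
      · exact hright 0
    | succ n ih =>
      have hcover : Iic (((n + 1 : ℕ) : ℝ) + 1) =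
          Iic ((n : ℝ) + 1) ∪ Icc ((n + 1 : ℕ) : ℝ) (((n + 1 : ℕ) : ℝ) + 1) := by
        push_cast
        exact (Iic_union_Icc_eq_Iic (by linarith)).symm
      rw [hcover]
      refine ih.union_of_isClosed ?_ isClosed_Iic isClosed_Icc
      refine (hlin (n + 1)).continuousOn.congr fun x hx => ?_
      rcases hx.2.lt_or_eq with h | rfl
      · have hf : ⌊x⌋₊ = n + 1 := (Nat.floor_eq_iff ((Nat.cast_nonneg _).trans hx.1)).2 ⟨hx.1, h⟩
        simp only [eval, hf]
      · exact hright (n + 1)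
  refine continuous_iff_continuousAt.2 fun x => ?_
  obtain ⟨n, hn⟩ := exists_nat_gt x
  exact (hIic n).continuousAt (Iic_mem_nhds (by linarith))

end PolygonalCurve

namespace IsReparam

variable {x₀ x₁ y₀ y₁ : ℝ} {σ θ : ℝ → ℝ}

theorem mem_Icc (h : IsReparam x₀ x₁ σ) {t : ℝ} (ht : t ∈ Icc (0 : ℝ) 1) : σ t ∈ Icc x₀ x₁ :=
  ⟨h.map_zero ▸ h.monotoneOn (left_mem_Icc.2 zero_le_one) ht ht.1,
    h.map_one ▸ h.monotoneOn ht (right_mem_Icc.2 zero_le_one) ht.2⟩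

theorem comp_affine (h : IsReparam x₀ x₁ σ) {a b : ℝ} (ha : 0 ≤ a) (hab : a ≤ b) (hb : b ≤ 1) :
    IsReparam (σ a) (σ b) fun t => σ (a + t * (b - a)) := by
  have hmaps : MapsTo (fun t : ℝ => a + t * (b - a)) (Icc 0 1) (Icc 0 1) := fun t ht => by
    have h0 := mul_nonneg ht.1 (sub_nonneg.2 hab)
    have h1 := mul_le_of_le_one_left (sub_nonneg.2 hab) ht.2
    constructor <;> linarith
  refine ⟨h.continuousOn.comp (by fun_prop) hmaps, fun s hs t ht hst => ?_, by simp, by simp⟩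
  refine h.monotoneOn (hmaps hs) (hmaps ht) ?_
  have := mul_le_mul_of_nonneg_right hst (sub_nonneg.2 hab)
  linarith

/-- A matching can be reparametrized by the sum of the two parameters. -/
theorem exists_monotonePath (hσ : IsReparam x₀ x₁ σ) (hθ : IsReparam y₀ y₁ θ) :
    ∃ r : ℝ → ℝ, ∀ s ∈ Icc (x₀ + y₀) (x₁ + y₁),
      (∀ t ∈ Icc (x₀ + y₀) (x₁ + y₁), s ≤ t → r s ≤ r t ∧ r t - r s ≤ t - s) ∧
      ∃ τ ∈ Icc (0 : ℝ) 1, r s = σ τ ∧ s - r s = θ τ := by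
  have hsurj : ∀ s ∈ Icc (x₀ + y₀) (x₁ + y₁), ∃ τ ∈ Icc (0 : ℝ) 1, σ τ + θ τ = s := by
    intro s hs
    refine intermediate_value_Icc zero_le_one (hσ.continuousOn.add hθ.continuousOn) ?_
    rwa [Pi.add_apply, Pi.add_apply, hσ.map_zero, hσ.map_one, hθ.map_zero, hθ.map_one]
  choose! τ hτ hsum using hsurj
  refine ⟨fun s => σ (τ s), fun s hs => ⟨fun t ht hst => ?_, τ s, hτ s hs, rfl, ?_⟩⟩
  · have h1 := hsum s hs
    have h2 := hsum t ht
    -- The chosen `τ` need not be monotone: in the reversed order both coordinates are forced to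
    -- agree.
    rcases le_total (τ s) (τ t) with h | h
    · have h3 := hσ.monotoneOn (hτ s hs) (hτ t ht) h
      have h4 := hθ.monotoneOn (hτ s hs) (hτ t ht) h
      constructor <;> linarith
    · have h3 := hσ.monotoneOn (hτ t ht) (hτ s hs) h
      have h4 := hθ.monotoneOn (hτ t ht) (hτ s hs) h
      constructor <;> linarith
  · linarith [hsum s hs]

end IsReparam

section maxDist

variable {d : ℕ} {P Q : PolygonalCurve d} {σ θ : ℝ → ℝ}

theorem maxDist_nonneg (a b : ℝ) : 0 ≤ maxDist P Q σ θ a b := by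
  refine Real.sSup_nonneg ?_
  rintro _ ⟨t, -, rfl⟩
  exact dist_nonneg

theorem IsReparam.dist_le_maxDist {x₀ x₁ y₀ y₁ : ℝ} (hσ : IsReparam x₀ x₁ σ)
    (hθ : IsReparam y₀ y₁ θ) {t : ℝ} (ht : t ∈ Icc (0 : ℝ) 1) :
    dist (P.eval (σ t)) (Q.eval (θ t)) ≤ maxDist P Q σ θ 0 1 :=
  le_csSup (isCompact_Icc.bddAbove_image
    (continuous_dist.comp_continuousOn
      ((P.continuous_eval.comp_continuousOn hσ.continuousOn).prodMk
        (Q.continuous_eval.comp_continuousOn hθ.continuousOn)))) (mem_image_of_mem _ ht)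

theorem maxDist_comp_affine {a b : ℝ} (hab : a ≤ b) :
    maxDist P Q (fun t => σ (a + t * (b - a))) (fun t => θ (a + t * (b - a))) 0 1 =
      maxDist P Q σ θ a b := by
  have himage : (fun t : ℝ => a + t * (b - a)) '' Icc 0 1 = Icc a b := by
    rw [← segment_eq_Icc hab, segment_eq_image']
    simp only [smul_eq_mul]
  unfold maxDist
  rw [← himage, image_image]

theorem subcurveFrechetDist_le {x₀ x₁ y₀ y₁ : ℝ} (hσ : IsReparam x₀ x₁ σ)
    (hθ : IsReparam y₀ y₁ θ) : subcurveFrechetDist P Q x₀ x₁ y₀ y₁ ≤ maxDist P Q σ θ 0 1 := by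
  refine csInf_le ⟨0, ?_⟩ ⟨σ, θ, hσ, hθ, rfl⟩
  rintro _ ⟨_, _, -, -, rfl⟩
  exact maxDist_nonneg 0 1

end maxDist

/-! ### Locally correct matchings -/

theorem exists_isLocallyCorrect {d : ℕ} (P Q : PolygonalCurve d) :
    ∃ σ θ : ℝ → ℝ, IsLocallyCorrect P Q σ θ := by
  have hG : Continuous (Function.uncurry fun s y : ℝ => dist (P.eval y) (Q.eval (s - y))) :=
    (P.continuous_eval.comp continuous_snd).dist
      (Q.continuous_eval.comp (continuous_fst.sub continuous_snd))
  have hn : (0 : ℝ) ≤ Q.m := Nat.cast_nonneg _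
  have hm : (0 : ℝ) ≤ P.m := Nat.cast_nonneg _
  set L : ℝ := P.m + Q.m with hL
  have hL0 : 0 ≤ L := add_nonneg hm hn
  obtain ⟨x, hx, hx0, hxL, hopt⟩ := exists_bottleneck_path hG (fun _ _ => dist_nonneg) hm
    (show (P.m : ℝ) ≤ L by linarith)
  have hmul : ∀ {s t : ℝ}, s ≤ t → L * s ≤ L * t := fun h => mul_le_mul_of_nonneg_left h hL0
  have hσ : IsReparam 0 P.m fun t => x (L * t) :=
    ⟨(hx.continuous.comp (by fun_prop)).continuousOn,
      fun s _ t _ hst => (hx _ _ (hmul hst)).1, by simpa using hx0, by simpa using hxL⟩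
  have hθ : IsReparam 0 Q.m fun t => L * t - x (L * t) :=
    ⟨((by fun_prop : Continuous fun t : ℝ => L * t).sub
        (hx.continuous.comp (by fun_prop))).continuousOn,
      fun s _ t _ hst => by linarith [(hx _ _ (hmul hst)).2], by simp [hx0],
      by rw [mul_one, hxL, hL, add_sub_cancel_left]⟩
  refine ⟨_, _, ⟨hσ, hθ⟩, fun a b ha hab hb => le_antisymm ?_ ?_⟩
  · refine le_csInf ⟨_, _, _, hσ.comp_affine ha hab hb, hθ.comp_affine ha hab hb, rfl⟩ ?_
    rintro _ ⟨σ', θ', hσ', hθ', rfl⟩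
    refine csSup_le ((nonempty_Icc.2 hab).image _) ?_
    rintro _ ⟨t, ht, rfl⟩
    have hLt : L * t ∈ Icc (L * a) (L * b) := ⟨hmul ht.1, hmul ht.2⟩
    rcases (hmul hab).lt_or_eq with hlt | heq
    · obtain ⟨r, hr⟩ := hσ'.exists_monotonePath hθ'
      -- The coordinates at time `a` sum to `L * a`, so `r` lives on `[L * a, L * b]`.
      simp only [add_sub_cancel] at hr
      refine hopt (L * a) (L * b) (mul_nonneg hL0 ha) hlt ((hmul hb).trans_eq (mul_one L)) r
        (maxDist P Q σ' θ' 0 1) (fun s hs => (hr s hs).1) (fun s hs => ?_) (fun s hs => ?_)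
        (L * t) hLt
      · obtain ⟨τ, hτ, h1, h2⟩ := (hr s hs).2
        rw [h2, h1]
        exact ⟨(hσ'.mem_Icc hτ).1, (hσ'.mem_Icc hτ).2, (hθ'.mem_Icc hτ).1, (hθ'.mem_Icc hτ).2⟩
      · obtain ⟨τ, hτ, h1, h2⟩ := (hr s hs).2
        rw [h2, h1]
        exact hσ'.dist_le_maxDist hθ' hτ
    -- Both subcurves are single points (as always when `L = 0`), and the rival's start already
    -- attains the distance.
    · have ht' : L * t = L * a := le_antisymm (hLt.2.trans_eq heq.symm) hLt.1
      have h := hσ'.dist_le_maxDist (P := P) (Q := Q) hθ' (left_mem_Icc.2 zero_le_one)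
      rw [hσ'.map_zero, hθ'.map_zero] at h
      simpa only [ht'] using h
  · rw [← maxDist_comp_affine hab]
    exact subcurveFrechetDist_le (hσ.comp_affine ha hab hb) (hθ.comp_affine ha hab hb)

theorem theorem1 (d : ℕ) (P Q : PolygonalCurve d) :
    ∃ σ θ : ℝ → ℝ, IsFrechetMatching P Q σ θ ∧ IsLocallyCorrect P Q σ θ := by
  obtain ⟨σ, θ, h⟩ := exists_isLocallyCorrect P Q
  refine ⟨σ, θ, ⟨h.1, ?_⟩, h⟩
  rw [h.2 0 1 le_rfl zero_le_one le_rfl, h.1.left.map_zero, h.1.left.map_one,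
    h.1.right.map_zero, h.1.right.map_one, frechetDist]
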